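/- **Setting.** Let $n\le d$ and let $\Omega$ be the Wiener space of continuous paths $[0,\infty)\to\mathbb R^d$ starting at $0$, with its natural filtration $\mathbf F=(\mathcal F_t)$. Let $r\in\mathbb R$ be the riskless rate, $\hat\mu\in\mathbb R^n$ and $\hat\sigma\in\mathbb R^{n\times d}$ the estimated drift and volatility, $\epsilon\ge 0$, and $K$ a compact set of invertible $n\times n$ matrices containing $\hat\sigma\hat\sigma'$. Let $S$ be the positive, continuous, adapted price process of the $n$ risky assets on $\Omega$. For each progressively measurable $\sigma$ with $\Sigma_t=\sigma_t\sigma_t'\in K$, let $P^{\hat\mu,\sigma}$ be a selected reference probability (whenever there is one) under which $dS_t=\mathrm{Diag}(S_t)(\hat\mu\,dt+\sigma_t\,dW_t)$ for a $d$-dimensional Brownian motion $W$. Let $\Upsilon$ be the set of pairs $\nu=(\mu,\sigma)$ of progressively measurable processes such that, for all $(\omega,t)$, $\Sigma_t\in K$ and $(\mu_t-\hat\mu)'\Sigma_t^{-1}(\mu_t-\hat\mu)\le\epsilon^2$, and for which there is a prior $P^\nu$: a probability whose density with respect to $P^{\hat\mu,\sigma}$ on each $\mathcal F_t$ is the Doléans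 exponential $\mathcal E(\int_0^\cdot\varphi'\,dW)_t$, $\varphi=\sigma'\Sigma^{-1}(\mu-\hat\mu)$, and under which $dS_t=\mathrm{Diag}(S_t)(\mu_t\,dt+\sigma_t\,dW^\nu_t)$ for a $d$-dimensional Brownian motion $W^\nu$. Write $\mathbb E^\nu$ for the expectation under $P^\nu$. A control is a pair $(\theta,c)$ of progressively measurable processes with values in $\mathbb R^n$ and $[0,\infty)$. Under $P^\nu$ its wealth $w$, started at $w_0>0$, solves $$dw_t=(r w_t+\theta_t'(\mu_t-r\mathbf 1)-c_t)\,dt+\theta_t'\sigma_t\,dW^\nu_t .$$ Let $\mathcal A_{\rm rob}(w_0)$ be the set of controls for which, under every $P^\nu$, $\nu\in\Upsilon$, this equation is meaningful (in particular $\int_0^\cdot c_s\,ds<\infty$ a.s.) and $w\ge0$ a.s. at all times. Let $0<T\le\infty$, and let $u(t,x)\in[-\infty,\infty)$, $t\in[0,T]$, $x\ge 0$, be finite for $x>0$, measurable in $t$, increasing and concave in $x$; if $T=\infty$, put $w_\infty=\limsup_{t\to\infty}w_t$ and assume $u(\infty,\cdot)=0$. The robust Merton problem is $$u_{opt}(w_0)=\sup_{(\theta,c)\in\mathcal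 A_{\rm rob}(w_0)}\ \inf_{\nu\in\Upsilon}\ \mathbb E^{\nu}\Big[\int_0^T u(t,c_t)\,dt+u(T,w_T)\Big],$$ where integrals are taken as $\int f^+-\int f^-$ with $\infty-\infty=-\infty$. **Theorem 1 (robust verification theorem).** Suppose that: 1. there is a function $V$ on $[0,T]\times[0,\infty)$ which is finite and continuous on $[0,T]\times(0,\infty)$ and $C^{1,2}$ on $[0,T)\times(0,\infty)$, with $V(T,\cdot)=u(T,\cdot)$ on $[0,\infty)$ (extended-real values are allowed at wealth $0$); 2. for every $(\theta,c)\in\mathcal A_{\rm rob}(w_0)$ there is an optimal solution $\nu(\theta,c)\in\Upsilon$ of the inner minimization such that $Y_t=V(t,w_t)+\int_0^t u(s,c_s)\,ds$, $t\in[0,T]$ (with $t=T=\infty$ included if $T=\infty$), is a (real, integrable) $P^{\nu(\theta,c)}$-supermartingale; 3. for some $(\bar\theta,\bar c)\in\mathcal A_{\rm rob}(w_0)$ the corresponding $\bar Y$ is a $P^{\nu(\bar\theta,\bar c)}$-martingale. Then $(\bar\theta,\bar c)$ is optimal for the robust Merton problem, and $u_{opt}(w_0)=V(0,w_0)$. 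-/

import Mathlib

open MeasureTheory ProbabilityTheory Filter Topology
open scoped NNReal ENNReal Matrix

namespace RobustMerton

noncomputable section

/-! ### Wiener space, its filtration, Lebesgue measure on the time axis -/

/-- The Wiener space of continuous paths `[0, ∞) → ℝ^d` starting at `0`, with the sigma-algebra
generated by the coordinates. -/
abbrev WienerSpace (d : ℕ) : Type :=
  {ω : ℝ≥0 → Fin d → ℝ // Continuous ω ∧ ω 0 = 0}

/-- The natural filtration of the coordinate process, indexed by `[0, ∞]`: the sigma-algebra at
time `t` is generated by the coordinates at the finite times `s ≤ t`. -/
def pathFiltration (d : ℕ) :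
    Filtration ℝ≥0∞ (inferInstance : MeasurableSpace (WienerSpace d)) where
  seq t := ⨆ (s : ℝ≥0) (_ : (s : ℝ≥0∞) ≤ t),
    MeasurableSpace.comap (fun ω : WienerSpace d => ω.1 s) inferInstance
  mono' _ _ hst := iSup_mono fun _ => iSup_mono' fun hs => ⟨hs.trans hst, le_rfl⟩
  le' _ := iSup_le fun s => iSup_le fun _ =>
    ((measurable_pi_apply s).comp measurable_subtype_coe).comap_le

/-- The natural filtration restricted to finite times. -/
def finiteFiltration (d : ℕ) :
    Filtration ℝ≥0 (inferInstance : MeasurableSpace (WienerSpace d)) where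
  seq t := pathFiltration d (t : ℝ≥0∞)
  mono' _ _ hst := (pathFiltration d).mono (ENNReal.coe_le_coe.2 hst)
  le' t := (pathFiltration d).le (t : ℝ≥0∞)

/-- The natural filtration augmented by the null sets of `P`. -/
def augmented {d : ℕ} (P : Measure (WienerSpace d)) :
    Filtration ℝ≥0∞ (inferInstance : MeasurableSpace (WienerSpace d)) where
  seq t := pathFiltration d t ⊔
    MeasurableSpace.generateFrom {A : Set (WienerSpace d) | MeasurableSet A ∧ P A = 0}
  mono' _ _ hst := sup_le_sup_right ((pathFiltration d).mono hst) _
  le' t := sup_le ((pathFiltration d).le t)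
    (MeasurableSpace.generateFrom_le fun _ hA => hA.1)

/-- The augmented filtration on the time interval `[0, T]`, `T ≤ ∞`. -/
def augmentedUpTo {d : ℕ} (P : Measure (WienerSpace d)) (T : ℝ≥0∞) :
    Filtration (Set.Iic T) (inferInstance : MeasurableSpace (WienerSpace d)) where
  seq t := augmented P (t : ℝ≥0∞)
  mono' _ _ hst := (augmented P).mono hst
  le' t := (augmented P).le (t : ℝ≥0∞)

/-- Lebesgue measure on `[0, ∞)`. -/
def leb : Measure ℝ≥0 := Measure.comap ((↑) : ℝ≥0 → ℝ) volume

/-- The integral of an extended-real function, `∫ f⁺ - ∫ f⁻`, with the convention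
`∞ - ∞ = -∞`. -/
def extIntegral {α : Type*} [MeasurableSpace α] (m : Measure α) (f : α → EReal) : EReal :=
  ((∫⁻ x, (f x).toENNReal ∂m : ℝ≥0∞) : EReal) - ((∫⁻ x, (-f x).toENNReal ∂m : ℝ≥0∞) : EReal)

/-! ### Brownian motion and the Itô integral under a measure on Wiener space -/

/-- `W` is a standard `d`-dimensional Brownian motion under `P`, relative to the augmented
natural filtration of Wiener space. -/
structure IsBrownian {d : ℕ} (P : Measure (WienerSpace d))
    (W : ℝ≥0 → WienerSpace d → Fin d → ℝ) : Prop where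
  adapted : ∀ t : ℝ≥0, Measurable[augmented P t] (W t)
  zero : ∀ᵐ ω ∂P, W 0 ω = 0
  cont : ∀ᵐ ω ∂P, Continuous fun t => W t ω
  law : ∀ s t : ℝ≥0, s ≤ t →
    P.map (fun ω => W t ω - W s ω) = Measure.pi fun _ : Fin d => gaussianReal 0 (t - s)
  indep : ∀ s t : ℝ≥0, s ≤ t →
    Indep (MeasurableSpace.comap (fun ω => W t ω - W s ω) inferInstance) (augmented P s) P

/-- Simple integrands `∑ k < N, ξ_k 1_{(t_k, t_{k+1}]}` with `ξ_k` bounded and measurable at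
time `t_k`. -/
structure SimpleProcess {d : ℕ} (P : Measure (WienerSpace d)) where
  N : ℕ
  t : ℕ → ℝ≥0
  ξ : ℕ → WienerSpace d → Fin d → ℝ
  mono : Monotone t
  meas : ∀ k, Measurable[augmented P (t k)] (ξ k)
  bdd : ∃ C : ℝ, ∀ k ω j, |ξ k ω j| ≤ C

/-- The value of a simple integrand. -/
def SimpleProcess.val {d : ℕ} {P : Measure (WienerSpace d)} (H : SimpleProcess P)
    (s : ℝ≥0) (ω : WienerSpace d) : Fin d → ℝ :=
  ∑ k ∈ Finset.range H.N, (Set.Ioc (H.t k) (H.t (k + 1))).indicator (fun _ => H.ξ k ω) s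

/-- The elementary stochastic integral of a simple integrand. -/
def SimpleProcess.integral {d : ℕ} {P : Measure (WienerSpace d)} (H : SimpleProcess P)
    (W : ℝ≥0 → WienerSpace d → Fin d → ℝ) (s : ℝ≥0) (ω : WienerSpace d) : ℝ :=
  ∑ k ∈ Finset.range H.N,
    H.ξ k ω ⬝ᵥ (W (min s (H.t (k + 1))) ω - W (min s (H.t k)) ω)

/-- `I` is (a continuous version of) the Itô integral `∫ H' dW` under `P`: it is the limit,
uniformly on compacts in probability, of elementary integrals of simple integrands `h_k` with
`∫₀ᵗ |h_k - H|² ds → 0` in probability for every `t`. -/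
structure IsIto {d : ℕ} (P : Measure (WienerSpace d))
    (W H : ℝ≥0 → WienerSpace d → Fin d → ℝ) (I : ℝ≥0 → WienerSpace d → ℝ) : Prop where
  adapted : ∀ t : ℝ≥0, Measurable[augmented P t] (I t)
  zero : ∀ᵐ ω ∂P, I 0 ω = 0
  cont : ∀ᵐ ω ∂P, Continuous fun t => I t ω
  approx : ∃ h : ℕ → SimpleProcess P,
    (∀ t : ℝ≥0, ∀ δ : ℝ≥0∞, 0 < δ → Tendsto
      (fun k => P {ω | δ ≤ ∫⁻ s in Set.Iic t,
        ENNReal.ofReal (((h k).val s ω - H s ω) ⬝ᵥ ((h k).val s ω - H s ω)) ∂leb})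
      atTop (𝓝 0)) ∧
    (∀ t : ℝ≥0, ∀ δ : ℝ, 0 < δ → Tendsto
      (fun k => P {ω | ∃ s ≤ t, δ ≤ |(h k).integral W s ω - I s ω|}) atTop (𝓝 0))

/-! ### The market and the prior models -/

/-- A pair `ν = (μ, σ)` of a drift process and a volatility process. -/
structure Coeffs (n d : ℕ) where
  drift : ℝ≥0 → WienerSpace d → Fin n → ℝ
  vol : ℝ≥0 → WienerSpace d → Matrix (Fin n) (Fin d) ℝ

/-- A pair `(θ, c)`: cash values held in the risky assets, and consumption rate. -/
structure Control (n d : ℕ) where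
  θ : ℝ≥0 → WienerSpace d → Fin n → ℝ
  c : ℝ≥0 → WienerSpace d → ℝ

/-- The data of the robust problem: riskless rate `r`, estimates `muHat`, `sigmaHat`, compact set
`K` of invertible matrices containing the estimated covariance matrix, ambiguity radius `ε`, the
price process of the `n` risky assets as a functional of the path, and, for each volatility process
`σ`, the selected reference probability `ref σ` (the measure `P^{muHat, σ}`). -/
structure Market (n d : ℕ) where
  dim_le : n ≤ d
  r : ℝ
  muHat : Fin n → ℝ
  sigmaHat : Matrix (Fin n) (Fin d) ℝ
  K : Set (Matrix (Fin n) (Fin n) ℝ)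
  K_compact : IsCompact K
  K_invertible : ∀ A ∈ K, IsUnit A.det
  sigmaHat_mem : sigmaHat * sigmaHatᵀ ∈ K
  ε : ℝ
  ε_nonneg : 0 ≤ ε
  S : ℝ≥0 → WienerSpace d → Fin n → ℝ
  S_adapted : ∀ t, Measurable[finiteFiltration d t] (S t)
  S_cont : ∀ ω, Continuous fun t => S t ω
  S_pos : ∀ t ω i, 0 < S t ω i
  ref : (ℝ≥0 → WienerSpace d → Matrix (Fin n) (Fin d) ℝ) → Measure (WienerSpace d)

namespace Market

variable {n d : ℕ} (M : Market n d)

/-- Under `P`, `W` is a Brownian motion and the prices satisfy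
`dS = Diag(S) (μ dt + σ dW)`. -/
def IsModel (P : Measure (WienerSpace d)) (ν : Coeffs n d)
    (W : ℝ≥0 → WienerSpace d → Fin d → ℝ) : Prop :=
  IsProbabilityMeasure P ∧ IsBrownian P W ∧
  ∀ i : Fin n, ∃ I : ℝ≥0 → WienerSpace d → ℝ,
    IsIto P W (fun t ω j => M.S t ω i * ν.vol t ω i j) I ∧
    ∀ᵐ ω ∂P, ∀ t : ℝ≥0,
      IntegrableOn (fun s => M.S s ω i * ν.drift s ω i) (Set.Iic t) leb ∧
      M.S t ω i = M.S 0 ω i + ∫ s in Set.Iic t, M.S s ω i * ν.drift s ω i ∂leb + I t ω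

/-- The process `φ = σ' Σ⁻¹ (μ - muHat)`, with `Σ = σ σ'`. -/
def phi (ν : Coeffs n d) (t : ℝ≥0) (ω : WienerSpace d) : Fin d → ℝ :=
  (ν.vol t ω)ᵀ *ᵥ ((ν.vol t ω * (ν.vol t ω)ᵀ)⁻¹ *ᵥ (ν.drift t ω - M.muHat))

/-- `P` is the prior `P^{μ, σ}`: the reference probability `ref σ` is a law under which the assets
have drift `muHat` and volatility `σ`; on each sigma-algebra of the natural filtration `P` has the
density `exp (∫ φ' dW - ½ ∫ |φ|² ds)` with respect to it; and the assets have coefficients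
`(μ, σ)` under `P`. -/
def IsPriorLaw (ν : Coeffs n d) (P : Measure (WienerSpace d)) : Prop :=
  (∃ W, M.IsModel P ν W) ∧
  ∃ (W : ℝ≥0 → WienerSpace d → Fin d → ℝ) (L : ℝ≥0 → WienerSpace d → ℝ),
    M.IsModel (M.ref ν.vol) ⟨fun _ _ => M.muHat, ν.vol⟩ W ∧
    IsIto (M.ref ν.vol) W (M.phi ν) L ∧
    ∀ (t : ℝ≥0) (A : Set (WienerSpace d)), MeasurableSet[finiteFiltration d t] A →
      P A = ∫⁻ ω in A, ENNReal.ofReal (Real.exp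
        (L t ω - (1 / 2) * ∫ s in Set.Iic t, M.phi ν s ω ⬝ᵥ M.phi ν s ω ∂leb)) ∂(M.ref ν.vol)

/-- The set `Υ` of plausible pairs `ν = (μ, σ)`: progressively measurable, `σ σ'` valued in `K`,
`μ` valued in the ellipsoid of radius `ε` around `muHat`, and such that the prior `P^{μ, σ}`
exists. -/
def Upsilon : Set (Coeffs n d) :=
  {ν | (∀ i, IsProgressive (finiteFiltration d) fun t ω => ν.drift t ω i) ∧
    (∀ i j, IsProgressive (finiteFiltration d) fun t ω => ν.vol t ω i j) ∧
    (∀ t ω, ν.vol t ω * (ν.vol t ω)ᵀ ∈ M.K) ∧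
    (∀ t ω, (ν.drift t ω - M.muHat) ⬝ᵥ
      ((ν.vol t ω * (ν.vol t ω)ᵀ)⁻¹ *ᵥ (ν.drift t ω - M.muHat)) ≤ M.ε ^ 2) ∧
    ∃ P, M.IsPriorLaw ν P}

/-- The prior `P^{μ, σ}`; it is determined by the coefficients. -/
def law (ν : Coeffs n d) : Measure (WienerSpace d) :=
  @Classical.epsilon _ ⟨0⟩ fun P => M.IsPriorLaw ν P

/-- A Brownian motion under `P^{μ, σ}` that drives the prices. The stochastic integrals
`∫ θ' σ dW` do not depend on which one is taken. -/
def bm (ν : Coeffs n d) : ℝ≥0 → WienerSpace d → Fin d → ℝ :=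
  @Classical.epsilon _ ⟨0⟩ fun W => M.IsModel (M.law ν) ν W

/-! ### Wealth, admissible controls -/

/-- Under `P^{μ, σ}`, `w` solves
`dw = (r w + θ' (μ - r 1) - c) dt + θ' σ dW`, with `w_0 = w0`. -/
structure IsWealth (w0 : ℝ) (ν : Coeffs n d) (a : Control n d)
    (w : ℝ≥0 → WienerSpace d → ℝ) : Prop where
  adapted : ∀ t : ℝ≥0, Measurable[augmented (M.law ν) t] (w t)
  cont : ∀ᵐ ω ∂(M.law ν), Continuous fun t => w t ω
  sde : ∃ I : ℝ≥0 → WienerSpace d → ℝ,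
    IsIto (M.law ν) (M.bm ν) (fun t ω => (ν.vol t ω)ᵀ *ᵥ a.θ t ω) I ∧
    ∀ᵐ ω ∂(M.law ν), ∀ t : ℝ≥0,
      IntegrableOn (fun s => a.c s ω) (Set.Iic t) leb ∧
      IntegrableOn (fun s => a.θ s ω ⬝ᵥ fun i => ν.drift s ω i - M.r) (Set.Iic t) leb ∧
      w t ω = w0 + ∫ s in Set.Iic t,
        (M.r * w s ω + (a.θ s ω ⬝ᵥ fun i => ν.drift s ω i - M.r) - a.c s ω) ∂leb + I t ω

/-- The wealth process under `P^{μ, σ}`: the solution of the wealth equation, unique up to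
indistinguishability. -/
def wealth (w0 : ℝ) (ν : Coeffs n d) (a : Control n d) : ℝ≥0 → WienerSpace d → ℝ :=
  @Classical.epsilon _ ⟨0⟩ fun w => M.IsWealth w0 ν a w

/-- The wealth at a time in `[0, ∞]`, where `w_∞ = limsup w_t`. -/
def wealthAt (w0 : ℝ) (ν : Coeffs n d) (a : Control n d) (t : ℝ≥0∞) (ω : WienerSpace d) : ℝ :=
  if t = ∞ then limsup (fun s : ℝ≥0 => M.wealth w0 ν a s ω) atTop
  else M.wealth w0 ν a t.toNNReal ω

/-- The robust admissible controls: progressively measurable, with `c ≥ 0`, such that under every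
prior the wealth equation makes sense and the wealth is almost surely nonnegative at all times. -/
def Admissible (w0 : ℝ) : Set (Control n d) :=
  {a | (∀ i, IsProgressive (finiteFiltration d) fun t ω => a.θ t ω i) ∧
    IsProgressive (finiteFiltration d) a.c ∧ (∀ t ω, 0 ≤ a.c t ω) ∧
    ∀ ν ∈ M.Upsilon, (∃ w, M.IsWealth w0 ν a w) ∧
      ∀ w, M.IsWealth w0 ν a w → ∀ᵐ ω ∂(M.law ν), ∀ t, 0 ≤ w t ω}

end Market

/-! ### Utility and the robust problem -/

/-- A utility function on `[0, T] × [0, ∞)`, `T ≤ ∞`, with values in `[-∞, ∞)`, the value `-∞`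
being possible only at wealth or consumption `0`: measurable in time, increasing and concave in the
second argument. If `T = ∞`, then `u(∞, ·) = 0`. -/
structure IsUtility (T : ℝ≥0∞) (u : ℝ≥0∞ → ℝ → EReal) : Prop where
  finite : ∀ t ≤ T, ∀ x, 0 < x → u t x ≠ ⊥ ∧ u t x ≠ ⊤
  meas : ∀ x, 0 ≤ x → Measurable fun t : Set.Iic T => u t x
  mono : ∀ t ≤ T, MonotoneOn (u t) (Set.Ici 0)
  concave : ∀ t ≤ T, ConcaveOn ℝ (Set.Ioi 0) fun x => (u t x).toReal
  infinite_horizon : T = ∞ → ∀ x, 0 ≤ x → u T x = 0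

/-- `V` is finite on `[0, T] × (0, ∞)`, continuous there, and `C^{1,2}` on `[0, T) × (0, ∞)`
(at time `0` the time derivative is one-sided). -/
def IsC12 (T : ℝ≥0∞) (V : ℝ≥0∞ → ℝ → EReal) : Prop :=
  (∀ t ≤ T, ∀ x, 0 < x → V t x ≠ ⊥ ∧ V t x ≠ ⊤) ∧
  ContinuousOn (fun p : ℝ≥0∞ × ℝ => V p.1 p.2) (Set.Iic T ×ˢ Set.Ioi 0) ∧
  ∃ Vt Vw Vww : ℝ × ℝ → ℝ,
    let D : Set (ℝ × ℝ) := {p | 0 ≤ p.1 ∧ ENNReal.ofReal p.1 < T ∧ 0 < p.2}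
    let v : ℝ → ℝ → ℝ := fun s x => (V (ENNReal.ofReal s) x).toReal
    ContinuousOn Vt D ∧ ContinuousOn Vw D ∧ ContinuousOn Vww D ∧
    ∀ p ∈ D, HasDerivWithinAt (fun s => v s p.2) (Vt p) (Set.Ici 0) p.1 ∧
      HasDerivAt (fun x => v p.1 x) (Vw p) p.2 ∧
      HasDerivAt (fun x => Vw (p.1, x)) (Vww p) p.2

/-- The real process `Y` on `[0, T]`, given with extended-real values, is a `P`-supermartingale:
at each time it is almost surely equal to a real supermartingale. -/
def IsSupermartingale {d : ℕ} (P : Measure (WienerSpace d)) (T : ℝ≥0∞)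
    (Y : ℝ≥0∞ → WienerSpace d → EReal) : Prop :=
  ∃ y : Set.Iic T → WienerSpace d → ℝ, Supermartingale y (augmentedUpTo P T) P ∧
    ∀ t : Set.Iic T, ∀ᵐ ω ∂P, Y t ω = (y t ω : EReal)

/-- Likewise for `P`-martingales. -/
def IsMartingale {d : ℕ} (P : Measure (WienerSpace d)) (T : ℝ≥0∞)
    (Y : ℝ≥0∞ → WienerSpace d → EReal) : Prop :=
  ∃ y : Set.Iic T → WienerSpace d → ℝ, Martingale y (augmentedUpTo P T) P ∧
    ∀ t : Set.Iic T, ∀ᵐ ω ∂P, Y t ω = (y t ω : EReal)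

/-- `∫₀ᵗ u(s, c_s) ds`, `t ≤ ∞`. -/
def runningUtility {n d : ℕ} (u : ℝ≥0∞ → ℝ → EReal) (a : Control n d) (t : ℝ≥0∞)
    (ω : WienerSpace d) : EReal :=
  extIntegral (leb.restrict {s : ℝ≥0 | (s : ℝ≥0∞) ≤ t}) fun s => u s (a.c s ω)

namespace Market

variable {n d : ℕ} (M : Market n d)

/-- `E^{(μ, σ)} [∫₀ᵀ u(t, c_t) dt + u(T, w_T)]`. -/
def expectedUtility (T : ℝ≥0∞) (u : ℝ≥0∞ → ℝ → EReal) (w0 : ℝ) (ν : Coeffs n d)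
    (a : Control n d) : EReal :=
  extIntegral (M.law ν) fun ω => runningUtility u a T ω + u T (M.wealthAt w0 ν a T ω)

/-- The worst-case expected utility of a control. -/
def robustUtility (T : ℝ≥0∞) (u : ℝ≥0∞ → ℝ → EReal) (w0 : ℝ) (a : Control n d) : EReal :=
  ⨅ ν ∈ M.Upsilon, M.expectedUtility T u w0 ν a

/-- The optimal value `u_opt(w0)` of the robust Merton problem. -/
def optimalValue (T : ℝ≥0∞) (u : ℝ≥0∞ → ℝ → EReal) (w0 : ℝ) : EReal :=
  ⨆ a ∈ M.Admissible w0, M.robustUtility T u w0 a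

/-- `ν` is an optimal solution of the inner minimization for the control `a`. -/
def IsWorstCase (T : ℝ≥0∞) (u : ℝ≥0∞ → ℝ → EReal) (w0 : ℝ) (a : Control n d)
    (ν : Coeffs n d) : Prop :=
  ν ∈ M.Upsilon ∧
    ∀ ν' ∈ M.Upsilon, M.expectedUtility T u w0 ν a ≤ M.expectedUtility T u w0 ν' a

/-- `a` is an optimal control for the robust Merton problem. -/
def IsOptimal (T : ℝ≥0∞) (u : ℝ≥0∞ → ℝ → EReal) (w0 : ℝ) (a : Control n d) : Prop :=
  a ∈ M.Admissible w0 ∧ M.robustUtility T u w0 a = M.optimalValue T u w0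

/-- The process `Y_t = V(t, w_t) + ∫₀ᵗ u(s, c_s) ds`. -/
def Y (u V : ℝ≥0∞ → ℝ → EReal) (w0 : ℝ) (ν : Coeffs n d) (a : Control n d)
    (t : ℝ≥0∞) (ω : WienerSpace d) : EReal :=
  V t (M.wealthAt w0 ν a t ω) + runningUtility u a t ω

end Market

end

end RobustMerton

/-!
The theorem is the martingale optimality principle. Fix an admissible control `a` and write
`P = M.law (ν a)`. The wealth starts at `w0` and stays nonnegative, so `Y` starts at `V 0 w0`, and
`V T = u T` on `[0, ∞)` makes `Y` at time `T` equal to the total utility of `a`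
(`RobustMerton.Market.Y_zero_ae`, `RobustMerton.Market.Y_horizon_ae`). Since `ν a` attains the
inner infimum, the worst-case utility of `a` is `E[Y_T]`
(`RobustMerton.Market.robustUtility_eq_of_isWorstCase`). The supermartingale property bounds it
by `E[Y_0] = V 0 w0`, and for `aBar` the martingale property gives equality.
-/

namespace RobustMerton

lemma extIntegral_congr_ae {α : Type*} [MeasurableSpace α] {m : Measure α} {f g : α → EReal}
    (h : f =ᵐ[m] g) : extIntegral m f = extIntegral m g := by
  have hpos : ∫⁻ x, (f x).toENNReal ∂m = ∫⁻ x, (g x).toENNReal ∂m :=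
    lintegral_congr_ae (h.mono fun x hx => by simp only [hx])
  have hneg : ∫⁻ x, (-f x).toENNReal ∂m = ∫⁻ x, (-g x).toENNReal ∂m :=
    lintegral_congr_ae (h.mono fun x hx => by simp only [hx])
  rw [extIntegral, extIntegral, hpos, hneg]

lemma extIntegral_coe {α : Type*} [MeasurableSpace α] {m : Measure α} {f : α → ℝ}
    (hf : Integrable f m) :
    extIntegral m (fun x => (f x : EReal)) = ((∫ x, f x ∂m : ℝ) : EReal) := by
  have hpos : ∫⁻ x, ENNReal.ofReal (f x) ∂m ≠ ∞ := hf.lintegral_lt_top.ne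
  have hneg : ∫⁻ x, ENNReal.ofReal (-f x) ∂m ≠ ∞ := hf.neg.lintegral_lt_top.ne
  rw [integral_eq_lintegral_pos_part_sub_lintegral_neg_part hf, EReal.coe_sub,
    EReal.coe_ennreal_toReal hpos, EReal.coe_ennreal_toReal hneg, extIntegral]
  simp only [← EReal.coe_neg, EReal.toENNReal_of_ne_top (EReal.coe_ne_top _), EReal.toReal_coe]

lemma leb_singleton (s : ℝ≥0) : leb {s} = 0 := by
  have h : MeasurableEmbedding ((↑) : ℝ≥0 → ℝ) :=
    MeasurableEmbedding.subtype_coe measurableSet_Ici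
  rw [leb, h.comap_apply, Set.image_singleton, Real.volume_singleton]

lemma runningUtility_zero {n d : ℕ} (u : ℝ≥0∞ → ℝ → EReal) (a : Control n d)
    (ω : WienerSpace d) : runningUtility u a 0 ω = 0 := by
  have hset : {s : ℝ≥0 | (s : ℝ≥0∞) ≤ 0} = {0} := by ext s; simp
  rw [runningUtility, hset, Measure.restrict_eq_zero.2 (leb_singleton 0)]
  simp [extIntegral]

namespace Market

variable {n d : ℕ} {M : Market n d} {T : ℝ≥0∞} {w0 : ℝ} {ν : Coeffs n d} {a : Control n d}
  {u V : ℝ≥0∞ → ℝ → EReal}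

lemma isProbabilityMeasure_law (hν : ν ∈ M.Upsilon) : IsProbabilityMeasure (M.law ν) := by
  obtain ⟨-, -, -, -, hP⟩ := hν
  have h : M.IsPriorLaw ν (M.law ν) := Classical.epsilon_spec hP
  obtain ⟨⟨W, hW⟩, -⟩ := h
  exact hW.1

lemma isWealth_wealth (ha : a ∈ M.Admissible w0) (hν : ν ∈ M.Upsilon) :
    M.IsWealth w0 ν a (M.wealth w0 ν a) :=
  Classical.epsilon_spec (ha.2.2.2 ν hν).1

lemma wealthAt_zero_ae (ha : a ∈ M.Admissible w0) (hν : ν ∈ M.Upsilon) :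
    ∀ᵐ ω ∂M.law ν, M.wealthAt w0 ν a 0 ω = w0 := by
  obtain ⟨I, hI, hsde⟩ := (isWealth_wealth ha hν).sde
  filter_upwards [hI.zero, hsde] with ω hI0 hω
  have hIic : (Set.Iic 0 : Set ℝ≥0) = {0} := by ext s; simp
  have h := (hω 0).2.2
  rw [hI0, hIic, Measure.restrict_eq_zero.2 (leb_singleton 0), integral_zero_measure] at h
  simpa [wealthAt] using h

/-- The wealth is nonnegative also at time `∞`: for an unbounded wealth path the real-valued
`limsup` is `0`. -/
lemma wealthAt_nonneg_ae (ha : a ∈ M.Admissible w0) (hν : ν ∈ M.Upsilon) (t : ℝ≥0∞) :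
    ∀ᵐ ω ∂M.law ν, 0 ≤ M.wealthAt w0 ν a t ω := by
  filter_upwards [(ha.2.2.2 ν hν).2 _ (isWealth_wealth ha hν)] with ω hω
  rw [wealthAt]
  split_ifs with ht
  · rw [limsup_eq]
    refine Real.sInf_nonneg fun b hb => ?_
    obtain ⟨s, hs⟩ := hb.exists
    exact (hω s).trans hs
  · exact hω _

lemma Y_zero_ae (ha : a ∈ M.Admissible w0) (hν : ν ∈ M.Upsilon) :
    ∀ᵐ ω ∂M.law ν, M.Y u V w0 ν a 0 ω = V 0 w0 := by
  filter_upwards [wealthAt_zero_ae ha hν] with ω hω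
  rw [Y, hω, runningUtility_zero, add_zero]

lemma Y_horizon_ae (ha : a ∈ M.Admissible w0) (hν : ν ∈ M.Upsilon)
    (hVT : ∀ x : ℝ, 0 ≤ x → V T x = u T x) :
    ∀ᵐ ω ∂M.law ν,
      runningUtility u a T ω + u T (M.wealthAt w0 ν a T ω) = M.Y u V w0 ν a T ω := by
  filter_upwards [wealthAt_nonneg_ae ha hν T] with ω hω
  rw [Y, hVT _ hω, add_comm]

lemma robustUtility_eq_of_isWorstCase (h : M.IsWorstCase T u w0 a ν) :
    M.robustUtility T u w0 a = M.expectedUtility T u w0 ν a :=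
  le_antisymm (iInf₂_le ν h.1) (le_iInf₂ h.2)

/-- If `Y` is given by an integrable real random variable at time `T`, then the expected utility
is its Bochner expectation. -/
lemma expectedUtility_eq_integral (ha : a ∈ M.Admissible w0) (hν : ν ∈ M.Upsilon)
    (hVT : ∀ x : ℝ, 0 ≤ x → V T x = u T x) {y : WienerSpace d → ℝ}
    (hy : Integrable y (M.law ν))
    (hY : ∀ᵐ ω ∂M.law ν, M.Y u V w0 ν a T ω = (y ω : EReal)) :
    M.expectedUtility T u w0 ν a = ((∫ ω, y ω ∂M.law ν : ℝ) : EReal) := by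
  rw [← extIntegral_coe hy]
  exact extIntegral_congr_ae ((Y_horizon_ae ha hν hVT).mp (hY.mono fun ω h h' => h'.trans h))

lemma integral_eq_of_Y_zero (ha : a ∈ M.Admissible w0) (hν : ν ∈ M.Upsilon)
    {y : WienerSpace d → ℝ} (hY : ∀ᵐ ω ∂M.law ν, M.Y u V w0 ν a 0 ω = (y ω : EReal)) :
    ((∫ ω, y ω ∂M.law ν : ℝ) : EReal) = V 0 w0 := by
  have := isProbabilityMeasure_law hν
  have hae : ∀ᵐ ω ∂M.law ν, (y ω : EReal) = V 0 w0 := by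
    filter_upwards [hY, Y_zero_ae (u := u) (V := V) ha hν] with ω h h'
    exact h.symm.trans h'
  obtain ⟨ω₀, hω₀⟩ := hae.exists
  have hconst : y =ᵐ[M.law ν] fun _ => y ω₀ := by
    filter_upwards [hae] with ω hω
    exact EReal.coe_eq_coe_iff.1 (hω.trans hω₀.symm)
  rw [integral_congr_ae hconst, integral_const, probReal_univ, one_smul, hω₀]

lemma expectedUtility_le_of_isSupermartingale (ha : a ∈ M.Admissible w0) (hν : ν ∈ M.Upsilon)
    (hVT : ∀ x : ℝ, 0 ≤ x → V T x = u T x)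
    (hY : IsSupermartingale (M.law ν) T (M.Y u V w0 ν a)) :
    M.expectedUtility T u w0 ν a ≤ V 0 w0 := by
  have := isProbabilityMeasure_law hν
  obtain ⟨y, hy, hYy⟩ := hY
  let start : Set.Iic T := ⟨0, Set.mem_Iic.2 zero_le⟩
  let horizon : Set.Iic T := ⟨T, Set.self_mem_Iic⟩
  have hle : start ≤ horizon := Subtype.mk_le_mk.2 zero_le
  rw [expectedUtility_eq_integral ha hν hVT (hy.integrable horizon) (hYy horizon),
    ← integral_eq_of_Y_zero ha hν (hYy start), EReal.coe_le_coe_iff]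
  simpa using hy.setIntegral_le hle (MeasurableSet.univ (m := augmentedUpTo (M.law ν) T start))

lemma expectedUtility_eq_of_isMartingale (ha : a ∈ M.Admissible w0) (hν : ν ∈ M.Upsilon)
    (hVT : ∀ x : ℝ, 0 ≤ x → V T x = u T x)
    (hY : IsMartingale (M.law ν) T (M.Y u V w0 ν a)) :
    M.expectedUtility T u w0 ν a = V 0 w0 := by
  have := isProbabilityMeasure_law hν
  obtain ⟨y, hy, hYy⟩ := hY
  let start : Set.Iic T := ⟨0, Set.mem_Iic.2 zero_le⟩
  let horizon : Set.Iic T := ⟨T, Set.self_mem_Iic⟩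
  have hle : start ≤ horizon := Subtype.mk_le_mk.2 zero_le
  rw [expectedUtility_eq_integral ha hν hVT (hy.integrable horizon) (hYy horizon),
    ← integral_eq_of_Y_zero ha hν (hYy start), EReal.coe_eq_coe_iff]
  simpa using
    (hy.setIntegral_eq hle (MeasurableSet.univ (m := augmentedUpTo (M.law ν) T start))).symm

end Market

end RobustMerton

theorem theorem1 {n d : ℕ} (M : RobustMerton.Market n d) (T : ℝ≥0∞) (hT : 0 < T)
    (w0 : ℝ) (hw0 : 0 < w0) (u : ℝ≥0∞ → ℝ → EReal) (hu : RobustMerton.IsUtility T u)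
    (V : ℝ≥0∞ → ℝ → EReal) (hV : RobustMerton.IsC12 T V)
    (hVT : ∀ x : ℝ, 0 ≤ x → V T x = u T x)
    (ν : RobustMerton.Control n d → RobustMerton.Coeffs n d)
    (hworst : ∀ a ∈ M.Admissible w0, M.IsWorstCase T u w0 a (ν a) ∧
      RobustMerton.IsSupermartingale (M.law (ν a)) T (M.Y u V w0 (ν a) a))
    (aBar : RobustMerton.Control n d) (haBar : aBar ∈ M.Admissible w0)
    (hmart : RobustMerton.IsMartingale (M.law (ν aBar)) T (M.Y u V w0 (ν aBar) aBar)) :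
    M.IsOptimal T u w0 aBar ∧ M.optimalValue T u w0 = V 0 w0 := by
  have hle : ∀ a ∈ M.Admissible w0, M.robustUtility T u w0 a ≤ V 0 w0 := fun a ha => by
    obtain ⟨hν, hY⟩ := hworst a ha
    rw [RobustMerton.Market.robustUtility_eq_of_isWorstCase hν]
    exact RobustMerton.Market.expectedUtility_le_of_isSupermartingale ha hν.1 hVT hY
  have heq : M.robustUtility T u w0 aBar = V 0 w0 := by
    have hν := (hworst aBar haBar).1
    rw [RobustMerton.Market.robustUtility_eq_of_isWorstCase hν]
    exact RobustMerton.Market.expectedUtility_eq_of_isMartingale haBar hν.1 hVT hmart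
  have hopt : M.optimalValue T u w0 = V 0 w0 :=
    le_antisymm (iSup₂_le hle) (heq.ge.trans (le_iSup₂ (f := fun a _ => M.robustUtility T u w0 a)
      aBar haBar))
  exact ⟨⟨haBar, heq.trans hopt.symm⟩, hopt⟩
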